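/- Let $\sigma\in(1,2]$. On $\mathbb R^n$, $n\ge1$, consider the thermoelastic plate system $u_{tt}+\Delta^2u+\Delta\theta+(-\Delta)^{\sigma}u_t=0$, $\theta_t-\Delta\theta-\Delta u_t=0$, with data $(u,u_t,\theta)(0)=(u_0,u_1,\theta_0)$. Normalise the Fourier transform so that $|D|=(-\Delta)^{1/2}$ has symbol $|\xi|$. Then $w^{(0)}:=(\hat u_t+|\xi|^2\hat u,\ \hat u_t-|\xi|^2\hat u,\ \hat\theta)^{\mathrm T}$ is the solution of the first-order system $$w^{(0)}_t+\left(|\xi|^2A_0+|\xi|^{2\sigma}A_1\right)w^{(0)}=0\quad(t>0),\qquad w^{(0)}(0,\xi)=w^{(0)}_0(\xi),$$ $$A_0=\tfrac12\begin{pmatrix}0&-2&-2\\2&0&-2\\1&1&2\end{pmatrix},\qquad A_1=\tfrac12\begin{pmatrix}1&1&0\\1&1&0\\0&0&0\end{pmatrix},$$ where $w_0^{(0)}=\mathcal F\left(u_1+|D|^2u_0,\ u_1-|D|^2u_0,\ \theta_0\right)^{\mathrm T}$. Let $$y_1=\tfrac13(1+z_1),\quad y_2=\tfrac13\left(1-\tfrac12z_1+\tfrac{\sqrt3}{2}iz_2\right),\quad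 y_3=\tfrac13\left(1-\tfrac12z_1-\tfrac{\sqrt3}{2}iz_2\right),$$ with $$z_1=\sqrt[3]{\tfrac12(3\sqrt{69}+11)}-\sqrt[3]{\tfrac12(3\sqrt{69}-11)},\quad z_2=\sqrt[3]{\tfrac12(3\sqrt{69}+11)}+\sqrt[3]{\tfrac12(3\sqrt{69}-11)};$$ these are the three roots of $y^3-y^2+2y-1=0$. Let $T_0\in\mathbb C^{3\times3}$ be an invertible matrix with $T_0^{-1}A_0T_0=\operatorname{diag}(y_1,y_2,y_3)$. Let $\tilde w$ be the Fourier transform in $x$ of the solution of the reference system $\tilde u_t-\operatorname{diag}(y_1,y_2,y_3)\Delta\tilde u=0$, $\tilde u(0)=\mathcal F^{-1}(T_0^{-1}w_0^{(0)})$; that is, $$\tilde w_t+|\xi|^2\operatorname{diag}(y_1,y_2,y_3)\,\tilde w=0\quad(t>0),\qquad \tilde w(0,\xi)=T_0^{-1}w_0^{(0)}(\xi).$$ Then there is $\varepsilon>0$, depending only on $\sigma$, such that the following holds for every $n\ge1$, $m\in[1,2]$, $s\ge0$, every such $T_0$, and every real-valued $\chi_{\mathrm{int}}\in C^\infty(\mathbb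 R^n)$ that vanishes outside $\{|\xi|\le\varepsilon\}$. There is a constant $C>0$, depending only on $\sigma,n,m,s,\chi_{\mathrm{int}},T_0$, such that for all data with $(|D|^2u_0,u_1,\theta_0)\in L^m(\mathbb R^n)^3$ and all $t\ge0$ the function $\chi_{\mathrm{int}}(D)\mathcal F^{-1}_{\xi\to x}(w^{(0)}-T_0\tilde w)(t,\cdot)$ belongs to $L^2(\mathbb R^n)\cap\dot H^s(\mathbb R^n)$ and $$\left\|\chi_{\mathrm{int}}(D)\mathcal F^{-1}_{\xi\to x}\left(w^{(0)}-T_0\tilde w\right)(t,\cdot)\right\|_{\dot H^s(\mathbb R^n)}\le C(1+t)^{-\frac{(2-m)n+2ms}{4m}-(\sigma-1)}\left(\||D|^2u_0\|_{L^m}+\|u_1\|_{L^m}+\|\theta_0\|_{L^m}\right).$$ -/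

import Mathlib

open MeasureTheory Set
open scoped FourierTransform SchwartzMap ContDiff ENNReal Laplacian

namespace ThermoPlate

/-- The space `ℝⁿ` with its Euclidean norm. -/
abbrev Space (n : ℕ) := EuclideanSpace ℝ (Fin n)

/-- The space `ℂ³` with its Hermitian norm. -/
abbrev C3 := EuclideanSpace ℂ (Fin 3)

/-- The Fourier symbol of `|D|`. The Fourier transform `𝓕` is normalised as
`𝓕 f ξ = ∫ exp (-2 π i ⟨x, ξ⟩) f x dx`, so the symbol of `-Δ` is `(2 π ‖ξ‖) ^ 2` and the symbol of
`|D| = (-Δ) ^ (1/2)` is `2 π ‖ξ‖`. -/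
noncomputable def absD {n : ℕ} (ξ : Space n) : ℝ := 2 * Real.pi * ‖ξ‖

/-- The coefficient matrix of the thermoelastic coupling. -/
noncomputable def A₀ : Matrix (Fin 3) (Fin 3) ℂ :=
  (1 / 2 : ℂ) • !![0, -2, -2; 2, 0, -2; 1, 1, 2]

/-- The coefficient matrix of the damping term. -/
noncomputable def A₁ : Matrix (Fin 3) (Fin 3) ℂ :=
  (1 / 2 : ℂ) • !![1, 1, 0; 1, 1, 0; 0, 0, 0]

/-- The symbol `|ξ|² A₀ + |ξ|^(2σ) A₁` of the first-order system. -/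
noncomputable def symbolA {n : ℕ} (σ : ℝ) (ξ : Space n) : Matrix (Fin 3) (Fin 3) ℂ :=
  ((absD ξ ^ 2 : ℝ) : ℂ) • A₀ + ((absD ξ ^ (2 * σ) : ℝ) : ℂ) • A₁

noncomputable def z₁ : ℝ :=
  ((3 * √69 + 11) / 2) ^ (1 / 3 : ℝ) - ((3 * √69 - 11) / 2) ^ (1 / 3 : ℝ)

noncomputable def z₂ : ℝ :=
  ((3 * √69 + 11) / 2) ^ (1 / 3 : ℝ) + ((3 * √69 - 11) / 2) ^ (1 / 3 : ℝ)

/-- The three roots `y₁, y₂, y₃` of `y³ - y² + 2 y - 1 = 0`, by Cardano's formula. -/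
noncomputable def yRoot : Fin 3 → ℂ :=
  ![(1 / 3) * (1 + (z₁ : ℂ)),
    (1 / 3) * (1 - (1 / 2) * (z₁ : ℂ) + ((√3 : ℝ) : ℂ) / 2 * Complex.I * (z₂ : ℂ)),
    (1 / 3) * (1 - (1 / 2) * (z₁ : ℂ) - ((√3 : ℝ) : ℂ) / 2 * Complex.I * (z₂ : ℂ))]

/-- The symbol `|ξ|² diag (y₁, y₂, y₃)` of the reference system `ũ_t - diag (y₁, y₂, y₃) Δ ũ = 0`. -/
noncomputable def symbolRef {n : ℕ} (ξ : Space n) : Matrix (Fin 3) (Fin 3) ℂ :=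
  ((absD ξ ^ 2 : ℝ) : ℂ) • Matrix.diagonal yRoot

/-- `T` diagonalises `A₀`: it is invertible and `T⁻¹ A₀ T = diag (y₁, y₂, y₃)`. -/
def Diagonalizes (T : Matrix (Fin 3) (Fin 3) ℂ) : Prop :=
  IsUnit T.det ∧ T⁻¹ * A₀ * T = Matrix.diagonal yRoot

/-- The function `v` represents the tempered distribution `u`. -/
def Represents {n : ℕ} (v : Space n → ℂ) (u : 𝓢'(Space n, ℂ)) : Prop :=
  ∀ φ : 𝓢(Space n, ℂ), Integrable (fun x => φ x * v x) ∧ u φ = ∫ x, φ x * v x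

/-- The Fourier transform of functions in `L²` (zero for other functions). -/
noncomputable def fourierL2 {n : ℕ} (f : Space n → C3) : Space n → C3 :=
  open scoped Classical in
  if h : MemLp f 2 volume then ⇑(𝓕 (h.toLp f) : Lp C3 2 (volume : Measure (Space n))) else 0

/-- The Fourier transform of functions in `L¹ + L²`, in particular of functions in `Lᵐ` with
`1 ≤ m ≤ 2`: such an `f` is split into its part where `1 < ‖f x‖`, which is in `L¹` and is
transformed by the Fourier integral, and its part where `‖f x‖ ≤ 1`, which is in `L²`. -/
noncomputable def fourierHat {n : ℕ} (f : Space n → C3) : Space n → C3 :=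
  fun ξ => 𝓕 ({x | 1 < ‖f x‖}.indicator f) ξ + fourierL2 ({x | ‖f x‖ ≤ 1}.indicator f) ξ

/-- `(u₁ + |D|² u₀, u₁ - |D|² u₀, θ₀)`, where `v₀` stands for `|D|² u₀`. -/
noncomputable def initialData {n : ℕ} (v₀ u₁ θ₀ : Space n → ℂ) : Space n → C3 :=
  fun x => !₂[u₁ x + v₀ x, u₁ x - v₀ x, θ₀ x]

/-- `w` solves `w_t + M(ξ) w = 0` for `t > 0` with `w(0, ξ) = w₀(ξ)`, for almost every frequency
`ξ`. -/
def IsFourierSolution {n : ℕ} (M : Space n → Matrix (Fin 3) (Fin 3) ℂ) (w₀ : Space n → C3)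
    (w : ℝ → Space n → C3) : Prop :=
  ∀ᵐ ξ : Space n, ContinuousOn (fun t => w t ξ) (Ici 0) ∧
    (∀ t > 0, HasDerivAt (fun τ => w τ ξ) (-(Matrix.toEuclideanLin (M ξ) (w t ξ))) t) ∧
    w 0 ξ = w₀ ξ

/-- The norm `‖|D|^s g‖` in `L²` of the homogeneous space `Ḣ^s`, by Plancherel, for `g` in `L²`;
it is `∞` if `g` is not in `Ḣ^s`. -/
noncomputable def homSobolevNorm {n : ℕ} (s : ℝ) (g : Lp C3 2 (volume : Measure (Space n))) :
    ℝ≥0∞ :=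
  eLpNorm (fun ξ => absD ξ ^ s • (𝓕 g : Lp C3 2 (volume : Measure (Space n))) ξ) 2 volume

end ThermoPlate

open ThermoPlate

namespace ThermoPlate

/-! Everything happens at a fixed frequency, by an energy argument instead of an asymptotic
diagonalisation. Write `q = |ξ|²` and `ρ = |ξ|^(2(σ-1))`, so that the symbol is `q (A₀ + ρ A₁)`.
Since `T₀` intertwines the reference system with `A₀`, the vector `z = T₀ w̃` solves `z_t + q A₀ z =
0` with the data of `w`, and `d = w - z` solves `d_t = -q (A₀ d + ρ A₁ (d + z))` with `d(0) = 0`.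

One quadratic form, the physical energy plus two small cross terms, is dissipated by `A₀ + ρ A₁` for
every `ρ ∈ [0, 1]`. The source `ρ A₁ z` is paid for by the dissipation of `z` itself: `energy d +
400 ρ² energy z` decays at rate `q / 20` (`energyDeriv_coupled_le`). Because `d` starts at zero,
`‖d‖ ≲ ρ exp (-q t / 40) ‖w₀‖` (`norm_sub_sq_le`); the factor `ρ` is the gain that becomes the extra
decay `(1 + t)^(-(σ-1))`.

It remains to bound `|ξ|^(s + 2(σ-1)) exp (-|ξ|² (1 + t) / 40)` as a multiplier from `𝓕 (Lᵐ)` to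
`L²` (`exists_eLpNorm_heatMultiplier_le`). Cutting the datum at a well-chosen height into an `L¹`
and an `L²` part does this directly (`eLpNorm_mul_fourierHat_le`), with no appeal to
Hausdorff–Young. Measurability in `ξ` comes from uniqueness: a solution must be the matrix
exponential applied to its data. -/

variable {n : ℕ}

/-! ### Lyapunov functional and the pointwise estimate at one frequency -/

/-- A quadratic form equivalent to the physical energy and strictly dissipated by the system. -/
def lyapunovForm (a b c : ℝ) : ℝ := 5 * a ^ 2 + 5 * b ^ 2 + 20 * c ^ 2 + 6 * a * c + 2 * a * b

/-- The derivative of `lyapunovForm` at `(a, b, c)` in the direction `(a', b', c')`. -/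
def lyapunovDeriv (a b c a' b' c' : ℝ) : ℝ :=
  (10 * a + 6 * c + 2 * b) * a' + (10 * b + 2 * a) * b' + (40 * c + 6 * a) * c'

/-- The diagonal part `5 a² + 5 b² + 20 c²` alone only dissipates `c²`. The cross term `6 a c`
transfers damping from `c` to `a`, and `2 a b` transfers it from `a` to `b`, so that the derivative
along `A₀` is `-a² - 2 b² - 28 c² - 6 a c - 2 b c`, which is negative definite. Here `(x, y, z)` is
the reference solution already multiplied by `ρ`. -/
lemma lyapunovDeriv_coupled_le {ρ : ℝ} (h0 : 0 ≤ ρ) (h1 : ρ ≤ 1) (a b c x y z : ℝ) :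
    lyapunovDeriv a b c (-b + 2 * c - ρ * a - x) a (-(a / 2) - c) +
      400 * lyapunovDeriv x y z (-y + 2 * z) x (-(x / 2) - z) ≤
    -(1 / 20) * (lyapunovForm a b c + 400 * lyapunovForm x y z) := by
  -- The spare `-x² / 4`, multiplied by the weight 400, cancels the `100 x²` that the source costs
  -- in `hd`.
  have hz : lyapunovDeriv x y z (-y + 2 * z) x (-(x / 2) - z) ≤
      -(1 / 20) * lyapunovForm x y z - x ^ 2 / 4 := by
    unfold lyapunovForm lyapunovDeriv
    nlinarith [sq_nonneg (x + 8 * z), sq_nonneg (y + z), sq_nonneg (x + y / 5), sq_nonneg x,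
      sq_nonneg y, sq_nonneg z]
  have hd : lyapunovDeriv a b c (-b + 2 * c - ρ * a - x) a (-(a / 2) - c) ≤
      -(1 / 20) * lyapunovForm a b c + 100 * x ^ 2 := by
    have key : ∀ ρ : ℝ, ρ = 0 ∨ ρ = 1 →
        lyapunovDeriv a b c (-b + 2 * c - ρ * a - x) a (-(a / 2) - c) ≤
          -(1 / 20) * lyapunovForm a b c + 100 * x ^ 2 := by
      unfold lyapunovForm lyapunovDeriv
      rintro ρ (rfl | rfl)
      · nlinarith [sq_nonneg (a + 8 * c), sq_nonneg (b + c), sq_nonneg (a + b / 5),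
          sq_nonneg (a + 40 * x), sq_nonneg (b + 10 * x), sq_nonneg (c + x), sq_nonneg a,
          sq_nonneg b, sq_nonneg c, sq_nonneg x]
      · nlinarith [sq_nonneg (a + c), sq_nonneg (b + c), sq_nonneg (a + b / 5),
          sq_nonneg (a + 10 * x), sq_nonneg (b + 10 * x), sq_nonneg (c + x), sq_nonneg a,
          sq_nonneg b, sq_nonneg c, sq_nonneg x]
    -- The derivative is affine in `ρ`, so the endpoints `ρ = 0` and `ρ = 1` suffice.
    have e : lyapunovDeriv a b c (-b + 2 * c - ρ * a - x) a (-(a / 2) - c) =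
        (1 - ρ) * lyapunovDeriv a b c (-b + 2 * c - 0 * a - x) a (-(a / 2) - c) +
          ρ * lyapunovDeriv a b c (-b + 2 * c - 1 * a - x) a (-(a / 2) - c) := by
      unfold lyapunovDeriv; ring
    rw [e]
    have k0 := mul_le_mul_of_nonneg_left (key 0 (Or.inl rfl)) (sub_nonneg.2 h1)
    have k1 := mul_le_mul_of_nonneg_left (key 1 (Or.inr rfl)) h0
    linarith
  linarith

lemma le_lyapunovForm (a b c : ℝ) : (a ^ 2 + b ^ 2) / 2 + c ^ 2 ≤ lyapunovForm a b c := by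
  unfold lyapunovForm
  nlinarith [sq_nonneg (a + 2 * c), sq_nonneg (a + b), sq_nonneg a, sq_nonneg b, sq_nonneg c]

lemma lyapunovForm_le (a b c : ℝ) :
    lyapunovForm a b c ≤ 40 * ((a ^ 2 + b ^ 2) / 2 + c ^ 2) := by
  unfold lyapunovForm
  nlinarith [sq_nonneg (a - c), sq_nonneg (a - b), sq_nonneg a, sq_nonneg b, sq_nonneg c]

lemma lyapunovForm_smul (r a b c : ℝ) :
    lyapunovForm (r * a) (r * b) (r * c) = r ^ 2 * lyapunovForm a b c := by
  unfold lyapunovForm; ring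

lemma HasDerivAt.lyapunovForm {a b c : ℝ → ℝ} {a' b' c' t : ℝ} (ha : HasDerivAt a a' t)
    (hb : HasDerivAt b b' t) (hc : HasDerivAt c c' t) :
    HasDerivAt (fun τ => lyapunovForm (a τ) (b τ) (c τ))
      (lyapunovDeriv (a t) (b t) (c t) a' b' c') t := by
  unfold ThermoPlate.lyapunovForm lyapunovDeriv
  have := (((((ha.pow 2).const_mul 5).add ((hb.pow 2).const_mul 5)).add
    ((hc.pow 2).const_mul 20)).add ((ha.const_mul 6).mul hc)).add ((ha.const_mul 2).mul hb)
  refine this.congr_deriv ?_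
  simp
  ring

/-- The Lyapunov functional on `ℂ³`. -/
noncomputable def energy (v : C3) : ℝ :=
  lyapunovForm (v 0 + v 1).re (v 0 - v 1).re (v 2).re +
    lyapunovForm (v 0 + v 1).im (v 0 - v 1).im (v 2).im

/-- The derivative of `energy` at `v` in the direction `v'`. -/
noncomputable def energyDeriv (v v' : C3) : ℝ :=
  lyapunovDeriv (v 0 + v 1).re (v 0 - v 1).re (v 2).re
      (v' 0 + v' 1).re (v' 0 - v' 1).re (v' 2).re +
    lyapunovDeriv (v 0 + v 1).im (v 0 - v 1).im (v 2).im
      (v' 0 + v' 1).im (v' 0 - v' 1).im (v' 2).im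

/-- Parallelogram identity for the coordinates `v 0 + v 1`, `v 0 - v 1`, `v 2`, which stand for `2
û_t`, `2 |ξ|² û`, `θ̂`. As `A₀` and `A₁` have real entries, real and imaginary parts can be treated
separately. -/
lemma norm_sq_eq_re_im (v : C3) : ‖v‖ ^ 2 =
    (((v 0 + v 1).re ^ 2 + (v 0 - v 1).re ^ 2) / 2 + (v 2).re ^ 2) +
      (((v 0 + v 1).im ^ 2 + (v 0 - v 1).im ^ 2) / 2 + (v 2).im ^ 2) := by
  rw [EuclideanSpace.norm_sq_eq, Fin.sum_univ_three]
  simp only [← Complex.normSq_eq_norm_sq, Complex.normSq_apply, Complex.add_re, Complex.sub_re,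
    Complex.add_im, Complex.sub_im]
  ring

lemma norm_sq_le_energy (v : C3) : ‖v‖ ^ 2 ≤ energy v := by
  rw [norm_sq_eq_re_im]
  exact add_le_add (le_lyapunovForm _ _ _) (le_lyapunovForm _ _ _)

lemma energy_le (v : C3) : energy v ≤ 40 * ‖v‖ ^ 2 := by
  rw [norm_sq_eq_re_im, mul_add]
  exact add_le_add (lyapunovForm_le _ _ _) (lyapunovForm_le _ _ _)

lemma continuous_energy : Continuous energy := by
  unfold energy lyapunovForm
  fun_prop

lemma HasDerivAt.energy {v : ℝ → C3} {v' : C3} {t : ℝ} (h : HasDerivAt v v' t) :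
    HasDerivAt (fun τ => energy (v τ)) (energyDeriv (v t) v') t := by
  have hc : ∀ i, HasDerivAt (fun τ => v τ i) (v' i) t := fun i =>
    ((EuclideanSpace.proj (𝕜 := ℂ) i).restrictScalars ℝ).hasFDerivAt.comp_hasDerivAt t h
  have re : ∀ {f : ℝ → ℂ} {f' : ℂ}, HasDerivAt f f' t →
      HasDerivAt (fun τ => (f τ).re) f'.re t := fun h =>
    Complex.reCLM.hasFDerivAt.comp_hasDerivAt t h
  have im : ∀ {f : ℝ → ℂ} {f' : ℂ}, HasDerivAt f f' t →
      HasDerivAt (fun τ => (f τ).im) f'.im t := fun h =>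
    Complex.imCLM.hasFDerivAt.comp_hasDerivAt t h
  exact (HasDerivAt.lyapunovForm (re ((hc 0).add (hc 1))) (re ((hc 0).sub (hc 1)))
    (re (hc 2))).add (HasDerivAt.lyapunovForm (im ((hc 0).add (hc 1)))
    (im ((hc 0).sub (hc 1))) (im (hc 2)))

lemma toEuclideanLin_A₀ (v : C3) : Matrix.toEuclideanLin A₀ v =
    !₂[-(v 1) - v 2, v 0 - v 2, (v 0 + v 1) / 2 + v 2] := by
  ext i
  fin_cases i <;>
    simp [A₀, Matrix.toLpLin_apply, dotProduct, Fin.sum_univ_three] <;> ring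

lemma toEuclideanLin_A₁ (v : C3) : Matrix.toEuclideanLin A₁ v =
    !₂[(v 0 + v 1) / 2, (v 0 + v 1) / 2, 0] := by
  ext i
  fin_cases i <;>
    simp [A₁, Matrix.toLpLin_apply, dotProduct, Fin.sum_univ_three] <;> ring

/-- The field `A₀ + ρ A₁` dissipates the energy of the difference `d` of two solutions, up to a
source term that is absorbed by the dissipation of the reference solution `z`. -/
lemma energyDeriv_coupled_le {ρ : ℝ} (h0 : 0 ≤ ρ) (h1 : ρ ≤ 1) (d z : C3) :
    energyDeriv d (-(Matrix.toEuclideanLin A₀ d + (ρ : ℂ) • Matrix.toEuclideanLin A₁ (d + z))) +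
      400 * ρ ^ 2 * energyDeriv z (-Matrix.toEuclideanLin A₀ z) ≤
    -(1 / 20) * (energy d + 400 * ρ ^ 2 * energy z) := by
  have hre := lyapunovDeriv_coupled_le h0 h1 (d 0 + d 1).re (d 0 - d 1).re (d 2).re
    (ρ * (z 0 + z 1).re) (ρ * (z 0 - z 1).re) (ρ * (z 2).re)
  have him := lyapunovDeriv_coupled_le h0 h1 (d 0 + d 1).im (d 0 - d 1).im (d 2).im
    (ρ * (z 0 + z 1).im) (ρ * (z 0 - z 1).im) (ρ * (z 2).im)
  refine (le_of_eq ?_).trans ((add_le_add hre him).trans (le_of_eq ?_))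
  · rw [toEuclideanLin_A₀, toEuclideanLin_A₁, toEuclideanLin_A₀]
    simp [energyDeriv, lyapunovDeriv]
    ring
  · rw [lyapunovForm_smul, lyapunovForm_smul]
    unfold energy
    ring

/-- Grönwall's inequality: `exp (κ t) F t` is nonincreasing. Continuity at `0` suffices there, as
the equation is only assumed for `t > 0`. -/
lemma le_exp_mul_of_deriv_le {F F' : ℝ → ℝ} {κ : ℝ} (hc : ContinuousOn F (Ici 0))
    (hd : ∀ t > 0, HasDerivAt F (F' t) t) (hle : ∀ t > 0, F' t ≤ -κ * F t) {t : ℝ} (ht : 0 ≤ t) :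
    F t ≤ Real.exp (-κ * t) * F 0 := by
  have hexp : ∀ t, HasDerivAt (fun t => Real.exp (κ * t)) (Real.exp (κ * t) * κ) t := fun t => by
    simpa using ((hasDerivAt_id t).const_mul κ).exp
  have hG : ∀ t > 0, HasDerivAt (fun t => Real.exp (κ * t) * F t)
      (Real.exp (κ * t) * κ * F t + Real.exp (κ * t) * F' t) t := fun t ht =>
    (hexp t).mul (hd t ht)
  have anti : AntitoneOn (fun t => Real.exp (κ * t) * F t) (Ici 0) := by
    refine antitoneOn_of_deriv_nonpos (convex_Ici 0) ?_ ?_ ?_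
    · exact (Continuous.continuousOn (by fun_prop)).mul hc
    · rw [interior_Ici]
      exact fun t ht => (hG t ht).differentiableAt.differentiableWithinAt
    · rw [interior_Ici]
      intro t ht
      rw [(hG t ht).deriv]
      nlinarith [mul_le_mul_of_nonneg_left (hle t ht) (Real.exp_pos (κ * t)).le]
  have := anti (mem_Ici.2 le_rfl) (mem_Ici.2 ht) ht
  simp only [mul_zero, Real.exp_zero, one_mul] at this
  rw [neg_mul, Real.exp_neg, ← div_eq_inv_mul, le_div_iff₀ (Real.exp_pos _), mul_comm]
  exact this

/-- Two solutions with the same data stay close, with the rate of the perturbation. -/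
lemma norm_sub_sq_le {q ρ : ℝ} (hq : 0 ≤ q) (h0 : 0 ≤ ρ) (h1 : ρ ≤ 1) {w z : ℝ → C3}
    (hwc : ContinuousOn w (Ici 0)) (hzc : ContinuousOn z (Ici 0))
    (hw : ∀ t > 0, HasDerivAt w
      (-Matrix.toEuclideanLin ((q : ℂ) • A₀ + ((q * ρ : ℝ) : ℂ) • A₁) (w t)) t)
    (hz : ∀ t > 0, HasDerivAt z (-Matrix.toEuclideanLin ((q : ℂ) • A₀) (z t)) t)
    (hwz : w 0 = z 0) {t : ℝ} (ht : 0 ≤ t) :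
    ‖w t - z t‖ ^ 2 ≤ 16000 * ρ ^ 2 * Real.exp (-(q / 20) * t) * ‖z 0‖ ^ 2 := by
  have hdd : ∀ t > 0, HasDerivAt (fun τ => energy (w τ - z τ) + 400 * ρ ^ 2 * energy (z τ))
      (q * (energyDeriv (w t - z t) (-(Matrix.toEuclideanLin A₀ (w t - z t) +
        (ρ : ℂ) • Matrix.toEuclideanLin A₁ (w t - z t + z t))) +
      400 * ρ ^ 2 * energyDeriv (z t) (-Matrix.toEuclideanLin A₀ (z t)))) t := by
    intro t ht
    refine ((HasDerivAt.energy ((hw t ht).sub (hz t ht))).add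
      ((HasDerivAt.energy (hz t ht)).const_mul _)).congr_deriv ?_
    have key : ∀ v v' : C3, energyDeriv v ((q : ℂ) • v') = q * energyDeriv v v' := by
      intro v v'
      simp [energyDeriv, lyapunovDeriv]
      ring
    have e1 : -Matrix.toEuclideanLin ((q : ℂ) • A₀ + ((q * ρ : ℝ) : ℂ) • A₁) (w t) -
        -Matrix.toEuclideanLin ((q : ℂ) • A₀) (z t) =
        (q : ℂ) • -(Matrix.toEuclideanLin A₀ (w t - z t) +
          (ρ : ℂ) • Matrix.toEuclideanLin A₁ (w t - z t + z t)) := by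
      simp only [map_add, map_smul, LinearMap.add_apply, LinearMap.smul_apply, map_sub,
        Complex.ofReal_mul, mul_smul]
      module
    have e2 : -Matrix.toEuclideanLin ((q : ℂ) • A₀) (z t) =
        (q : ℂ) • -Matrix.toEuclideanLin A₀ (z t) := by
      simp only [map_smul, LinearMap.smul_apply, smul_neg]
    simp only [Pi.sub_apply]
    rw [e1, e2, key, key]
    ring
  have main := le_exp_mul_of_deriv_le (κ := q / 20)
    (F := fun τ => energy (w τ - z τ) + 400 * ρ ^ 2 * energy (z τ))
    ((continuous_energy.comp_continuousOn (hwc.sub hzc)).add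
      (continuousOn_const.mul (continuous_energy.comp_continuousOn hzc))) hdd
    (fun t _ => by
      have := mul_le_mul_of_nonneg_left (energyDeriv_coupled_le h0 h1 (w t - z t) (z t)) hq
      linarith) ht
  -- The difference vanishes initially, so only `400 ρ² energy (z 0)` is left; `energy_le`
  -- contributes 40, whence `16000 = 400 · 40`.
  have e0 : energy 0 = 0 := by simp [energy, lyapunovForm]
  simp only [hwz, sub_self, e0, zero_add] at main
  have hz0 : 0 ≤ energy (z t) := (sq_nonneg _).trans (norm_sq_le_energy _)
  have hb := mul_le_mul_of_nonneg_left (energy_le (z 0))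
    (show 0 ≤ Real.exp (-(q / 20) * t) * (400 * ρ ^ 2) by positivity)
  have := norm_sq_le_energy (w t - z t)
  have : 0 ≤ 400 * ρ ^ 2 * energy (z t) := by positivity
  linarith

/-! ### Fourier transform on `L¹` and on `L²` -/

lemma fourierL2_congr {f g : Space n → C3} (h : f =ᵐ[volume] g) : fourierL2 f = fourierL2 g := by
  unfold fourierL2
  by_cases hf : MemLp f 2 volume
  · have hg : MemLp g 2 volume := hf.ae_eq h
    rw [dif_pos hf, dif_pos hg, (MemLp.toLp_eq_toLp_iff hf hg).2 h]
  · have hg : ¬ MemLp g 2 volume := fun hg => hf (hg.ae_eq h.symm)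
    rw [dif_neg hf, dif_neg hg]

lemma fourierL2_ae_eq {f : Space n → C3} (hf : MemLp f 2 volume) :
    fourierL2 f =ᵐ[volume] (𝓕 (hf.toLp f) : Lp C3 2 (volume : Measure (Space n))) := by
  rw [fourierL2, dif_pos hf]

lemma aestronglyMeasurable_fourierL2 (f : Space n → C3) :
    AEStronglyMeasurable (fourierL2 f) volume := by
  by_cases hf : MemLp f 2 volume
  · exact (Lp.aestronglyMeasurable _).congr (fourierL2_ae_eq hf).symm
  · rw [fourierL2, dif_neg hf]
    exact aestronglyMeasurable_zero

lemma eLpNorm_fourierL2 {f : Space n → C3} (hf : MemLp f 2 volume) :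
    eLpNorm (fourierL2 f) 2 volume = eLpNorm f 2 volume := by
  rw [eLpNorm_congr_ae (fourierL2_ae_eq hf), ← Lp.enorm_def, ← ofReal_norm, Lp.norm_fourier_eq,
    ofReal_norm, Lp.enorm_def, eLpNorm_congr_ae hf.coeFn_toLp]

lemma fourierL2_add {f g : Space n → C3} (hf : MemLp f 2 volume) (hg : MemLp g 2 volume) :
    fourierL2 (f + g) =ᵐ[volume] fourierL2 f + fourierL2 g := by
  have e : 𝓕 ((hf.add hg).toLp (f + g)) = 𝓕 (hf.toLp f) + 𝓕 (hg.toLp g) := by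
    rw [MemLp.toLp_add, FourierTransform.fourier_add]
  refine (fourierL2_ae_eq (hf.add hg)).trans ?_
  rw [e]
  filter_upwards [fourierL2_ae_eq hf, fourierL2_ae_eq hg,
    Lp.coeFn_add (𝓕 (hf.toLp f)) (𝓕 (hg.toLp g))] with x h1 h2 h3
  rw [h3, Pi.add_apply, Pi.add_apply, h1, h2]

lemma continuous_fourier_of_integrable {f : Space n → C3} (hf : Integrable f volume) :
    Continuous (𝓕 f) :=
  VectorFourier.fourierIntegral_continuous Real.continuous_fourierChar
    (innerSL ℝ).continuous₂ hf

/-- On `L¹ ∩ L²` the Fourier integral is the Fourier transform of `L²`. -/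
lemma fourierL2_ae_eq_fourier {f : Space n → C3} (hf : Integrable f volume)
    (hf2 : MemLp f 2 volume) : fourierL2 f =ᵐ[volume] 𝓕 f := by
  refine (fourierL2_ae_eq hf2).trans ?_
  -- Both sides are tested against compactly supported smooth functions. On the `L²` side the
  -- transform moves to the test function by compatibility with tempered distributions, on the `L¹`
  -- side by Fubini.
  refine ae_eq_of_integral_contDiff_smul_eq ((Lp.memLp _).locallyIntegrable (by norm_num))
    (continuous_fourier_of_integrable hf).locallyIntegrable ?_
  intro g g_smooth g_cpt
  have hg₁ : HasCompactSupport (Complex.ofRealCLM ∘ g) := g_cpt.comp_left rfl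
  have hg₂ : ContDiff ℝ ∞ (Complex.ofRealCLM ∘ g) := by fun_prop
  set φ : 𝓢(Space n, ℂ) := hg₁.toSchwartzMap hg₂ with hφ
  have hφg : ∀ x, φ x = (g x : ℂ) := fun x => rfl
  have h1 := congrArg (fun T : 𝓢'(Space n, C3) => T φ)
    (Lp.fourier_toTemperedDistribution_eq (hf2.toLp f))
  simp only [TemperedDistribution.fourier_apply, Lp.toTemperedDistribution_apply] at h1
  have h2 : ∫ x, φ x • 𝓕 f x = ∫ x, 𝓕 φ x • f x := by
    have := VectorFourier.integral_fourierIntegral_smul_eq_flip (μ := volume) (ν := volume)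
      (L := innerₗ (Space n)) Real.continuous_fourierChar continuous_inner
      (φ.integrable (μ := volume)) hf
    rw [flip_innerₗ] at this
    exact this.symm
  calc ∫ x, g x • (𝓕 (hf2.toLp f) : Lp C3 2 (volume : Measure (Space n))) x
      = ∫ x, φ x • (𝓕 (hf2.toLp f) : Lp C3 2 (volume : Measure (Space n))) x := by
        simp only [hφg, Complex.coe_smul]
    _ = ∫ x, 𝓕 φ x • (hf2.toLp f) x := h1.symm
    _ = ∫ x, 𝓕 φ x • f x := by
        refine integral_congr_ae ?_
        filter_upwards [hf2.coeFn_toLp] with x hx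
        rw [hx]
    _ = ∫ x, φ x • 𝓕 f x := h2.symm
    _ = ∫ x, g x • 𝓕 f x := by simp only [hφg, Complex.coe_smul]

lemma fourier_add_of_integrable {f g : Space n → C3} (hf : Integrable f volume)
    (hg : Integrable g volume) : 𝓕 (f + g) = 𝓕 f + 𝓕 g :=
  VectorFourier.fourierIntegral_add Real.continuous_fourierChar
    (innerSL ℝ).continuous₂ hf hg

lemma norm_fourier_le (f : Space n → C3) (ξ : Space n) : ‖𝓕 f ξ‖ ≤ ∫ x, ‖f x‖ :=
  VectorFourier.norm_fourierIntegral_le_integral_norm _ _ _ _ _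

/-! ### Splitting at a height, and multipliers from `𝓕 (Lᵐ)` to `L²` -/

section Split

variable {f : Space n → C3} {m l : ℝ}

lemma nullMeasurableSet_lt_norm (hf : AEStronglyMeasurable f volume) (l : ℝ) :
    NullMeasurableSet {x | l < ‖f x‖} volume :=
  nullMeasurableSet_lt aemeasurable_const hf.norm.aemeasurable

lemma nullMeasurableSet_norm_le (hf : AEStronglyMeasurable f volume) (l : ℝ) :
    NullMeasurableSet {x | ‖f x‖ ≤ l} volume :=
  nullMeasurableSet_le hf.norm.aemeasurable aemeasurable_const

lemma integrable_norm_rpow_of_memLp (hm : 1 ≤ m) (hf : MemLp f (ENNReal.ofReal m) volume) :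
    Integrable (fun x => ‖f x‖ ^ m) volume := by
  have := hf.integrable_norm_rpow (by simp; linarith) ENNReal.ofReal_ne_top
  rwa [ENNReal.toReal_ofReal (by linarith)] at this

lemma norm_indicator_lt_le (hm : 1 ≤ m) (hl : 0 < l) (x : Space n) :
    ‖{x | l < ‖f x‖}.indicator f x‖ ≤ l ^ (1 - m) * ‖f x‖ ^ m := by
  by_cases hx : l < ‖f x‖
  · rw [indicator_of_mem (by exact hx)]
    have hpos : 0 < ‖f x‖ := hl.trans hx
    calc ‖f x‖ = ‖f x‖ ^ (1 - m) * ‖f x‖ ^ m := by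
          rw [← Real.rpow_add hpos]; simp
      _ ≤ _ := by
          gcongr ?_ * _
          exact Real.rpow_le_rpow_of_nonpos hl hx.le (by linarith)
  · rw [indicator_of_notMem (by exact hx), norm_zero]
    positivity

lemma norm_indicator_le_sq_le (hm : 1 ≤ m) (hm2 : m ≤ 2) (hl : 0 < l) (x : Space n) :
    ‖{x | ‖f x‖ ≤ l}.indicator f x‖ ^ 2 ≤ l ^ (2 - m) * ‖f x‖ ^ m := by
  by_cases hx : ‖f x‖ ≤ l
  · rw [indicator_of_mem (by exact hx)]
    calc ‖f x‖ ^ 2 = ‖f x‖ ^ (2 - m) * ‖f x‖ ^ m := by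
          rw [← Real.rpow_add_of_nonneg (norm_nonneg _) (by linarith) (by linarith)]; simp
      _ ≤ _ := by gcongr
  · rw [indicator_of_notMem (by exact hx), norm_zero, zero_pow two_ne_zero]
    positivity

lemma integrable_indicator_lt (hm : 1 ≤ m) (hl : 0 < l) (hf : MemLp f (ENNReal.ofReal m) volume) :
    Integrable ({x | l < ‖f x‖}.indicator f) volume :=
  ((integrable_norm_rpow_of_memLp hm hf).const_mul (l ^ (1 - m))).mono'
    (hf.1.indicator₀ (nullMeasurableSet_lt_norm hf.1 l))
    (Filter.Eventually.of_forall fun x => norm_indicator_lt_le hm hl x)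

lemma memLp_two_indicator_le (hm : 1 ≤ m) (hm2 : m ≤ 2) (hl : 0 < l)
    (hf : MemLp f (ENNReal.ofReal m) volume) :
    MemLp ({x | ‖f x‖ ≤ l}.indicator f) 2 volume := by
  have hmeas := hf.1.indicator₀ (nullMeasurableSet_norm_le hf.1 l)
  rw [memLp_two_iff_integrable_sq_norm hmeas]
  refine ((integrable_norm_rpow_of_memLp hm hf).const_mul (l ^ (2 - m))).mono'
    (hmeas.norm.pow 2) (Filter.Eventually.of_forall fun x => ?_)
  rw [Real.norm_of_nonneg (by positivity)]
  exact norm_indicator_le_sq_le hm hm2 hl x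

lemma integral_norm_indicator_lt_le (hm : 1 ≤ m) (hl : 0 < l)
    (hf : MemLp f (ENNReal.ofReal m) volume) :
    ∫ x, ‖{x | l < ‖f x‖}.indicator f x‖ ≤ l ^ (1 - m) * ∫ x, ‖f x‖ ^ m := by
  rw [← integral_const_mul]
  exact integral_mono (integrable_indicator_lt hm hl hf).norm
    ((integrable_norm_rpow_of_memLp hm hf).const_mul _) fun x => norm_indicator_lt_le hm hl x

lemma eLpNorm_indicator_le_le (hm : 1 ≤ m) (hm2 : m ≤ 2) (hl : 0 < l)
    (hf : MemLp f (ENNReal.ofReal m) volume) :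
    eLpNorm ({x | ‖f x‖ ≤ l}.indicator f) 2 volume ≤
      ENNReal.ofReal ((l ^ (2 - m) * ∫ x, ‖f x‖ ^ m) ^ (1 / 2 : ℝ)) := by
  have h2 := memLp_two_indicator_le hm hm2 hl hf
  rw [h2.eLpNorm_eq_integral_rpow_norm (by norm_num) (by norm_num), ← integral_const_mul]
  simp only [ENNReal.toReal_ofNat, Real.rpow_ofNat, one_div]
  gcongr
  · exact (memLp_two_iff_integrable_sq_norm h2.1).1 h2
  · exact (integrable_norm_rpow_of_memLp hm hf).const_mul _
  · exact fun x => norm_indicator_le_sq_le hm hm2 hl x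

/-- The Fourier transform of `Lᵐ` does not depend on the height at which functions are split. -/
lemma fourierHat_ae_eq (hm : 1 ≤ m) (hm2 : m ≤ 2) (hl : 0 < l)
    (hf : MemLp f (ENNReal.ofReal m) volume) :
    fourierHat f =ᵐ[volume]
      𝓕 ({x | l < ‖f x‖}.indicator f) + fourierL2 ({x | ‖f x‖ ≤ l}.indicator f) := by
  have hl1 : (0 : ℝ) < 1 := one_pos
  set a := {x | l < ‖f x‖}.indicator f with ha
  set b := {x | ‖f x‖ ≤ l}.indicator f with hb
  set a' := {x | 1 < ‖f x‖}.indicator f with ha'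
  set b' := {x | ‖f x‖ ≤ 1}.indicator f with hb'
  have ia : Integrable a := integrable_indicator_lt hm hl hf
  have ia' : Integrable a' := integrable_indicator_lt hm hl1 hf
  have ib : MemLp b 2 := memLp_two_indicator_le hm hm2 hl hf
  have ib' : MemLp b' 2 := memLp_two_indicator_le hm hm2 hl1 hf
  have sum : ∀ c : ℝ, {x | c < ‖f x‖}.indicator f + {x | ‖f x‖ ≤ c}.indicator f = f := by
    intro c
    have : {x | ‖f x‖ ≤ c} = {x | c < ‖f x‖}ᶜ := by ext; simp
    rw [this, indicator_self_add_compl]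
  -- What moves between the parts when the height changes lies in `L¹` (left side) and in `L²`
  -- (right side), where the two transforms agree.
  have hd : a' - a = b - b' := by
    rw [sub_eq_sub_iff_add_eq_add, sum 1, add_comm, sum l]
  have hL := fourierL2_ae_eq_fourier (ia'.sub ia) (by rw [hd]; exact ib.sub ib')
  have e1 : 𝓕 a' = 𝓕 a + 𝓕 (a' - a) := by
    rw [← fourier_add_of_integrable ia (ia'.sub ia)]; simp
  have e2 : fourierL2 b =ᵐ[volume] fourierL2 b' + fourierL2 (a' - a) := by
    have := fourierL2_add ib' (ib.sub ib')
    rw [hd]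
    simpa using this
  filter_upwards [hL, e2] with ξ h1 h2
  change 𝓕 a' ξ + fourierL2 b' ξ = 𝓕 a ξ + fourierL2 b ξ
  rw [h2, e1, Pi.add_apply, Pi.add_apply, h1]
  abel

lemma aestronglyMeasurable_fourierHat (hm : 1 ≤ m) (hf : MemLp f (ENNReal.ofReal m) volume) :
    AEStronglyMeasurable (fourierHat f) volume :=
  (continuous_fourier_of_integrable (integrable_indicator_lt hm one_pos hf)).aestronglyMeasurable.add
    (aestronglyMeasurable_fourierL2 _)

lemma fourierHat_ae_eq_zero (hf : f =ᵐ[volume] 0) : fourierHat f =ᵐ[volume] 0 := by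
  have h : ∀ s : Set (Space n), s.indicator f =ᵐ[volume] 0 := fun s => by
    filter_upwards [hf] with x hx
    by_cases h : x ∈ s <;> simp [h, hx]
  have h1 : ∀ ξ, 𝓕 ({x | 1 < ‖f x‖}.indicator f) ξ = 0 := fun ξ => by
    rw [Real.fourier_congr_ae (h _), Real.fourier_eq]; simp
  have h2 : fourierL2 ({x | ‖f x‖ ≤ 1}.indicator f) =ᵐ[volume] 0 := by
    rw [fourierL2_congr (h _)]
    have hz : MemLp (0 : Space n → C3) 2 volume := MemLp.zero
    refine (fourierL2_ae_eq hz).trans ?_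
    rw [MemLp.toLp_zero, FourierTransform.fourier_zero]
    exact Lp.coeFn_zero _ _ _
  filter_upwards [h2] with ξ hξ
  simp [fourierHat, h1, hξ]

/-- A bounded square integrable multiplier maps `𝓕 (Lᵐ)` to `L²`, with the interpolated norm. -/
lemma eLpNorm_mul_fourierHat_le (hm : 1 ≤ m) (hm2 : m ≤ 2)
    (hf : MemLp f (ENNReal.ofReal m) volume) {ψ : Space n → ℝ} (hψ : AEStronglyMeasurable ψ volume)
    {K μ : ℝ} (hK : 0 ≤ K) (hμ : 0 < μ) (hψ0 : ∀ ξ, 0 ≤ ψ ξ) (hψK : ∀ ξ, ψ ξ ≤ K)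
    (hψ2 : eLpNorm ψ 2 volume ≤ ENNReal.ofReal (K * μ)) :
    eLpNorm (fun ξ => ψ ξ * ‖fourierHat f ξ‖) 2 volume ≤
      ENNReal.ofReal (2 * K * μ ^ ((2 - m) / m)) * eLpNorm f (ENNReal.ofReal m) volume := by
  have hm0 : 0 < m := by linarith
  set I := ∫ x, ‖f x‖ ^ m with hI
  have hI0 : 0 ≤ I := integral_nonneg fun x => by positivity
  have hN : eLpNorm f (ENNReal.ofReal m) volume = ENNReal.ofReal (I ^ (1 / m)) := by
    rw [hf.eLpNorm_eq_integral_rpow_norm (by simpa using hm0) ENNReal.ofReal_ne_top,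
      ENNReal.toReal_ofReal hm0.le, one_div]
  -- The zero function is set apart because the cutting height below would be `0`.
  rcases hI0.eq_or_lt with hz | hpos
  · have : f =ᵐ[volume] 0 := by
      rw [← eLpNorm_eq_zero_iff hf.1 (by simpa using hm0 : ENNReal.ofReal m ≠ 0), hN, ← hz,
        Real.zero_rpow (by positivity), ENNReal.ofReal_zero]
    have h0 : (fun ξ => ψ ξ * ‖fourierHat f ξ‖) =ᵐ[volume] 0 := by
      filter_upwards [fourierHat_ae_eq_zero this] with ξ hξ
      simp [hξ]
    rw [eLpNorm_congr_ae h0, eLpNorm_zero]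
    exact zero_le
  -- This height solves `l^m = I μ²` and balances the two contributions: the `L¹` part gives
  -- `l^(1-m) I μ`, the `L²` part `(l^(2-m) I)^(1/2)`, and both equal `R`.
  set l := I ^ (1 / m) * μ ^ (2 / m) with hl
  have hl0 : 0 < l := by positivity
  set R := I ^ (1 / m) * μ ^ ((2 - m) / m) with hR
  have k1 : l ^ (1 - m) * I * μ = R := by
    rw [hl, hR, Real.mul_rpow (by positivity) (by positivity), ← Real.rpow_mul hI0,
      ← Real.rpow_mul hμ.le]
    calc _ = (I ^ (1 / m * (1 - m)) * I ^ (1 : ℝ)) * (μ ^ (2 / m * (1 - m)) * μ ^ (1 : ℝ)) := by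
          rw [Real.rpow_one, Real.rpow_one]; ring
      _ = _ := by
          rw [← Real.rpow_add hpos, ← Real.rpow_add hμ]
          congr 2 <;> field_simp <;> ring
  have k2 : (l ^ (2 - m) * I) ^ (1 / 2 : ℝ) = R := by
    have e : l ^ (2 - m) = I ^ (1 / m * (2 - m)) * μ ^ (2 / m * (2 - m)) := by
      rw [hl, Real.mul_rpow (by positivity) (by positivity), ← Real.rpow_mul hI0,
        ← Real.rpow_mul hμ.le]
    rw [e, hR]
    calc _ = (I ^ (1 / m * (2 - m)) * I ^ (1 : ℝ) * μ ^ (2 / m * (2 - m))) ^ (1 / 2 : ℝ) := by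
          rw [Real.rpow_one]; ring_nf
      _ = _ := by
          rw [← Real.rpow_add hpos, Real.mul_rpow (by positivity) (by positivity),
            ← Real.rpow_mul hI0, ← Real.rpow_mul hμ.le]
          congr 2
          · field_simp; ring
          · field_simp
  set F := fourierL2 ({x | ‖f x‖ ≤ l}.indicator f) with hF
  have hFm : AEStronglyMeasurable F volume := aestronglyMeasurable_fourierL2 _
  have bd : ∀ᵐ ξ, ‖ψ ξ * ‖fourierHat f ξ‖‖ ≤ (l ^ (1 - m) * I) * ψ ξ + K * ‖F ξ‖ := by
    filter_upwards [fourierHat_ae_eq hm hm2 hl0 hf] with ξ hξ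
    rw [Real.norm_of_nonneg (mul_nonneg (hψ0 ξ) (norm_nonneg _)), hξ]
    have h1 := (norm_fourier_le ({x | l < ‖f x‖}.indicator f) ξ).trans
      (integral_norm_indicator_lt_le hm hl0 hf)
    have h2 := (norm_add_le (𝓕 ({x | l < ‖f x‖}.indicator f) ξ) (F ξ)).trans
      (add_le_add_left h1 _)
    calc _ ≤ ψ ξ * (l ^ (1 - m) * I + ‖F ξ‖) := mul_le_mul_of_nonneg_left h2 (hψ0 ξ)
      _ = (l ^ (1 - m) * I) * ψ ξ + ψ ξ * ‖F ξ‖ := by ring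
      _ ≤ _ := by gcongr; exact hψK ξ
  have hF2 : eLpNorm (fun ξ => ‖F ξ‖) 2 volume ≤ ENNReal.ofReal R := by
    rw [eLpNorm_norm, hF, eLpNorm_fourierL2 (memLp_two_indicator_le hm hm2 hl0 hf), ← k2]
    exact eLpNorm_indicator_le_le hm hm2 hl0 hf
  calc eLpNorm (fun ξ => ψ ξ * ‖fourierHat f ξ‖) 2 volume
      ≤ eLpNorm ((fun ξ => (l ^ (1 - m) * I) * ψ ξ) + fun ξ => K * ‖F ξ‖) 2 volume :=
        eLpNorm_mono_ae_real bd
    _ ≤ eLpNorm (fun ξ => (l ^ (1 - m) * I) * ψ ξ) 2 volume +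
        eLpNorm (fun ξ => K * ‖F ξ‖) 2 volume :=
        eLpNorm_add_le (hψ.const_mul _) (hFm.norm.const_mul _) (by norm_num)
    _ = ENNReal.ofReal (l ^ (1 - m) * I) * eLpNorm ψ 2 volume +
        ENNReal.ofReal K * eLpNorm (fun ξ => ‖F ξ‖) 2 volume := by
        have c : ∀ (k : ℝ) (g : Space n → ℝ), 0 ≤ k →
            eLpNorm (fun ξ => k * g ξ) 2 volume = ENNReal.ofReal k * eLpNorm g 2 volume := by
          intro k g hk
          have := eLpNorm_const_smul k g 2 (volume : Measure (Space n))
          rwa [Real.enorm_eq_ofReal hk] at this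
        rw [c _ _ (by positivity), c _ _ hK]
    _ ≤ ENNReal.ofReal (l ^ (1 - m) * I) * ENNReal.ofReal (K * μ) +
        ENNReal.ofReal K * ENNReal.ofReal R := by gcongr
    _ = ENNReal.ofReal (2 * K * μ ^ ((2 - m) / m)) * eLpNorm f (ENNReal.ofReal m) volume := by
        rw [hN, ← ENNReal.ofReal_mul (by positivity), ← ENNReal.ofReal_mul hK,
          ← ENNReal.ofReal_mul (by positivity), ← ENNReal.ofReal_add (by positivity)
            (by positivity)]
        congr 1
        rw [show l ^ (1 - m) * I * (K * μ) = K * (l ^ (1 - m) * I * μ) by ring, k1, hR]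
        ring

end Split

/-! ### Gaussian integrals and decay of the heat multiplier -/

lemma absD_nonneg (ξ : Space n) : 0 ≤ absD ξ := by unfold absD; positivity

lemma continuous_absD : Continuous (absD : Space n → ℝ) := by unfold absD; fun_prop

lemma integral_exp_neg_absD_sq {τ : ℝ} (hτ : 0 < τ) :
    ∫ ξ : Space n, Real.exp (-(absD ξ ^ 2 * τ / 40)) = (10 / (Real.pi * τ)) ^ ((n : ℝ) / 2) := by
  have hb : 0 < Real.pi ^ 2 * τ / 10 := by positivity
  have h := GaussianFourier.integral_rexp_neg_mul_sq_norm (V := Space n) hb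
  rw [finrank_euclideanSpace_fin] at h
  convert h using 2
  · ext ξ
    congr 1
    unfold absD
    ring
  · field_simp

lemma eLpNorm_exp_neg_absD_sq {τ : ℝ} (hτ : 0 < τ) :
    eLpNorm (fun ξ : Space n => Real.exp (-(absD ξ ^ 2 * τ / 80))) 2 volume =
      ENNReal.ofReal ((10 / (Real.pi * τ)) ^ ((n : ℝ) / 4)) := by
  have hsq : ∀ ξ : Space n, Real.exp (-(absD ξ ^ 2 * τ / 80)) ^ 2 =
      Real.exp (-(absD ξ ^ 2 * τ / 40)) := fun ξ => by
    rw [← Real.exp_nat_mul]; congr 1; push_cast; ring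
  have hint : Integrable (fun ξ : Space n => Real.exp (-(absD ξ ^ 2 * τ / 40))) volume := by
    -- A nonintegrable function has integral `0` by convention, so the positive value computed above
    -- forces integrability.
    refine not_imp_comm.1 integral_undef ?_
    rw [integral_exp_neg_absD_sq hτ]
    positivity
  have hmeas : AEStronglyMeasurable (fun ξ : Space n => Real.exp (-(absD ξ ^ 2 * τ / 80))) volume :=
    (Continuous.aestronglyMeasurable (by have := continuous_absD (n := n); fun_prop))
  have hmem : MemLp (fun ξ : Space n => Real.exp (-(absD ξ ^ 2 * τ / 80))) 2 volume := by
    rw [memLp_two_iff_integrable_sq hmeas]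
    simpa only [hsq] using hint
  rw [hmem.eLpNorm_eq_integral_rpow_norm (by norm_num) (by norm_num)]
  simp only [ENNReal.toReal_ofNat, Real.rpow_ofNat, Real.norm_eq_abs, sq_abs, hsq]
  rw [integral_exp_neg_absD_sq hτ, ← Real.rpow_mul (by positivity)]
  congr 2
  ring

/-- Raise `y ≤ exp y` to the power `b` for `y = c x / (b + 1)`. Dividing by `b + 1` rather than `b`
keeps `b = 0` admissible. -/
lemma rpow_le_mul_exp {b c x : ℝ} (hb : 0 ≤ b) (hc : 0 < c) (hx : 0 ≤ x) :
    x ^ b ≤ ((b + 1) / c) ^ b * Real.exp (c * x) := by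
  have h1 : c * x / (b + 1) ≤ Real.exp (c * x / (b + 1)) := by
    linarith [Real.add_one_le_exp (c * x / (b + 1))]
  have e : x = (b + 1) / c * (c * x / (b + 1)) := by field_simp
  calc x ^ b = ((b + 1) / c) ^ b * (c * x / (b + 1)) ^ b := by
        rw [← Real.mul_rpow (by positivity) (by positivity), ← e]
    _ ≤ ((b + 1) / c) ^ b * Real.exp (c * x / (b + 1)) ^ b := by gcongr
    _ = ((b + 1) / c) ^ b * Real.exp (c * x / (b + 1) * b) := by rw [Real.exp_mul]
    _ ≤ _ := by
        refine mul_le_mul_of_nonneg_left (Real.exp_le_exp.2 ?_) (by positivity)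
        rw [div_mul_eq_mul_div, div_le_iff₀ (by positivity)]
        nlinarith [mul_nonneg hc.le hx]

/-- The multiplier `|ξ|ᵃ exp (-|ξ|² τ / 40)`. -/
noncomputable def heatMultiplier (a τ : ℝ) (ξ : Space n) : ℝ :=
  absD ξ ^ a * Real.exp (-(absD ξ ^ 2 * τ / 40))

lemma heatMultiplier_nonneg (a τ : ℝ) (ξ : Space n) : 0 ≤ heatMultiplier a τ ξ :=
  mul_nonneg (Real.rpow_nonneg (absD_nonneg ξ) _) (Real.exp_pos _).le

lemma continuous_heatMultiplier {a : ℝ} (ha : 0 ≤ a) (τ : ℝ) :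
    Continuous (heatMultiplier a τ : Space n → ℝ) := by
  have h := continuous_absD (n := n)
  exact (h.rpow_const fun _ => Or.inr ha).mul (by fun_prop)

/-- Half of the Gaussian exponent absorbs the power of `|ξ|`, at the price `τ^(-a/2)`; the other
half remains for the `L²` norm. -/
lemma heatMultiplier_le {a τ : ℝ} (ha : 0 ≤ a) (hτ : 0 < τ) (ξ : Space n) :
    heatMultiplier a τ ξ ≤ ((a / 2 + 1) * 80) ^ (a / 2) * τ ^ (-(a / 2)) *
      Real.exp (-(absD ξ ^ 2 * τ / 80)) := by
  have hr := absD_nonneg ξ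
  have h := rpow_le_mul_exp (b := a / 2) (c := 1 / 80) (x := absD ξ ^ 2 * τ) (by positivity)
    (by norm_num) (by positivity)
  have e : absD ξ ^ a = τ ^ (-(a / 2)) * (absD ξ ^ 2 * τ) ^ (a / 2) := by
    rw [Real.mul_rpow (by positivity) hτ.le, ← Real.rpow_natCast_mul hr, mul_left_comm,
      ← Real.rpow_add hτ]
    simp [mul_div_cancel₀]
  unfold heatMultiplier
  rw [e]
  calc _ ≤ τ ^ (-(a / 2)) * (((a / 2 + 1) / (1 / 80)) ^ (a / 2) *
        Real.exp (1 / 80 * (absD ξ ^ 2 * τ))) * Real.exp (-(absD ξ ^ 2 * τ / 40)) := by gcongr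
    _ = ((a / 2 + 1) * 80) ^ (a / 2) * τ ^ (-(a / 2)) *
        (Real.exp (1 / 80 * (absD ξ ^ 2 * τ)) * Real.exp (-(absD ξ ^ 2 * τ / 40))) := by
        rw [show (a / 2 + 1) / (1 / 80) = (a / 2 + 1) * 80 by ring]; ring
    _ = _ := by rw [← Real.exp_add]; congr 2; ring

/-- The `Lᵐ`-`L²` decay estimate for the heat multiplier. -/
lemma exists_eLpNorm_heatMultiplier_le (n : ℕ) {m a : ℝ} (hm : 1 ≤ m) (hm2 : m ≤ 2)
    (ha : 0 ≤ a) : ∃ K : ℝ, 0 < K ∧ ∀ τ > 0, ∀ f : Space n → C3,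
      MemLp f (ENNReal.ofReal m) volume →
      eLpNorm (fun ξ => heatMultiplier a τ ξ * ‖fourierHat f ξ‖) 2 volume ≤
        ENNReal.ofReal (K * τ ^ (-((2 - m) * n / (4 * m)) - a / 2)) *
          eLpNorm f (ENNReal.ofReal m) volume := by
  have hm0 : 0 < m := by linarith
  set Ka := ((a / 2 + 1) * 80) ^ (a / 2) with hKa
  have hKa0 : 0 < Ka := by positivity
  refine ⟨2 * Ka * (10 / Real.pi) ^ ((2 - m) * n / (4 * m)), by positivity, fun τ hτ f hf => ?_⟩
  have hK0 : 0 < Ka * τ ^ (-(a / 2)) := by positivity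
  have hle := fun ξ : Space n => heatMultiplier_le ha hτ ξ
  rw [← hKa] at hle
  refine (eLpNorm_mul_fourierHat_le hm hm2 hf (K := Ka * τ ^ (-(a / 2)))
    (μ := (10 / (Real.pi * τ)) ^ ((n : ℝ) / 4))
    (continuous_heatMultiplier ha τ).aestronglyMeasurable hK0.le (by positivity)
    (heatMultiplier_nonneg a τ) (fun ξ => (hle ξ).trans ?_) ?_).trans (le_of_eq ?_)
  · refine mul_le_of_le_one_right hK0.le (Real.exp_le_one_iff.2 ?_)
    have : 0 ≤ absD ξ ^ 2 * τ := by positivity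
    linarith
  · calc eLpNorm (heatMultiplier a τ : Space n → ℝ) 2 volume
        ≤ eLpNorm ((Ka * τ ^ (-(a / 2))) •
            fun ξ : Space n => Real.exp (-(absD ξ ^ 2 * τ / 80))) 2 volume :=
          eLpNorm_mono_real fun ξ => by
            rw [Real.norm_of_nonneg (heatMultiplier_nonneg a τ ξ)]
            exact hle ξ
      _ = _ := by
          rw [eLpNorm_const_smul, Real.enorm_eq_ofReal hK0.le, eLpNorm_exp_neg_absD_sq hτ,
            ENNReal.ofReal_mul hK0.le]
  · congr 2
    rw [← Real.rpow_mul (by positivity), show (10 : ℝ) / (Real.pi * τ) = 10 / Real.pi * τ⁻¹ by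
      field_simp, Real.mul_rpow (by positivity) (by positivity), Real.inv_rpow hτ.le,
      ← Real.rpow_neg hτ.le, show (n : ℝ) / 4 * ((2 - m) / m) = (2 - m) * n / (4 * m) by field_simp,
      sub_eq_add_neg (-((2 - m) * n / (4 * m))), Real.rpow_add hτ]
    ring

/-! ### Uniqueness of solutions and measurability in the frequency -/

/-- Solutions of a linear system with constant coefficients are given by the exponential. -/
lemma eq_exp_of_hasDerivAt (A : C3 →L[ℂ] C3) {w : ℝ → C3} (hc : ContinuousOn w (Ici 0))
    (hd : ∀ t > 0, HasDerivAt w (-A (w t)) t) {t : ℝ} (ht : 0 ≤ t) :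
    w t = NormedSpace.exp (-t • A) (w 0) := by
  let +nondep : NormedAlgebra ℚ (C3 →L[ℂ] C3) := .restrictScalars ℚ ℂ _
  have hexp : ∀ τ : ℝ, HasDerivAt (fun τ : ℝ => NormedSpace.exp (τ • A))
      (NormedSpace.exp (τ • A) * A) τ := fun τ => hasDerivAt_exp_smul_const A τ
  have hg : ∀ τ > 0, HasDerivAt (fun τ : ℝ => NormedSpace.exp (τ • A) (w τ)) 0 τ := by
    intro τ hτ
    have hr := (((ContinuousLinearMap.restrictScalarsL ℂ C3 C3 ℝ ℝ).hasFDerivAt).comp_hasDerivAt τ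
      (hexp τ)).clm_apply (hd τ hτ)
    refine hr.congr_deriv ?_
    simp
  have hcg : ContinuousOn (fun τ : ℝ => NormedSpace.exp (τ • A) (w τ)) (Ici 0) :=
    ContinuousOn.clm_apply (fun τ _ => (hexp τ).continuousAt.continuousWithinAt) hc
  -- With rate `0`, the squared distance of `exp (τ A) w(τ)` from `w 0` cannot exceed its initial
  -- value, which is zero.
  have hF := le_exp_mul_of_deriv_le (κ := 0)
    (F := fun τ : ℝ => ‖NormedSpace.exp (τ • A) (w τ) - w 0‖ ^ 2) (F' := fun _ => 0)
    ((hcg.sub continuousOn_const).norm.pow 2)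
    (fun τ hτ => by simpa using ((hg τ hτ).sub_const (w 0)).norm_sq) (by simp) ht
  have hexp0 : NormedSpace.exp ((0 : ℝ) • A) = 1 := by
    rw [zero_smul ℝ A, NormedSpace.exp_zero]
  rw [hexp0, one_apply_eq_self, sub_self, norm_zero] at hF
  have h0 : NormedSpace.exp (t • A) (w t) = w 0 := by
    rw [← sub_eq_zero, ← norm_eq_zero]
    nlinarith [norm_nonneg (NormedSpace.exp (t • A) (w t) - w 0)]
  have hinv : NormedSpace.exp (-t • A) * NormedSpace.exp (t • A) = 1 := by
    rw [neg_smul t A]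
    refine (NormedSpace.exp_add_of_commute (Commute.refl (t • A)).neg_left).symm.trans ?_
    rw [neg_add_cancel, NormedSpace.exp_zero]
  rw [← h0, ← mul_apply_eq_comp, hinv, one_apply_eq_self]

lemma aestronglyMeasurable_exp_apply {A : Space n → C3 →L[ℂ] C3} (hA : Continuous A)
    {w₀ : Space n → C3} (hw₀ : AEStronglyMeasurable w₀ volume) (t : ℝ) :
    AEStronglyMeasurable (fun ξ => NormedSpace.exp (t • A ξ) (w₀ ξ)) volume := by
  let +nondep : NormedAlgebra ℚ (C3 →L[ℂ] C3) := .restrictScalars ℚ ℂ _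
  have hE : Continuous fun ξ => NormedSpace.exp (t • A ξ) :=
    NormedSpace.exp_continuous.comp (hA.const_smul t)
  exact (isBoundedBilinearMap_apply (𝕜 := ℂ) (E := C3) (F := C3)).continuous.comp_aestronglyMeasurable
    (hE.aestronglyMeasurable.prodMk hw₀)

/-- A solution of `w_t + M(ξ) w = 0` with measurable data is measurable at each time. -/
lemma IsFourierSolution.aestronglyMeasurable {M : Space n → Matrix (Fin 3) (Fin 3) ℂ}
    {w₀ : Space n → C3} {w : ℝ → Space n → C3} (h : IsFourierSolution M w₀ w)
    (hM : Continuous fun ξ => Matrix.toEuclideanCLM (n := Fin 3) (𝕜 := ℂ) (M ξ))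
    (hw₀ : AEStronglyMeasurable w₀ volume) {t : ℝ} (ht : 0 ≤ t) :
    AEStronglyMeasurable (w t) volume := by
  refine (aestronglyMeasurable_exp_apply hM hw₀ (-t)).congr ?_
  filter_upwards [h] with ξ ⟨h1, h2, h3⟩
  rw [← h3]
  exact (eq_exp_of_hasDerivAt (Matrix.toEuclideanCLM (n := Fin 3) (𝕜 := ℂ) (M ξ)) h1
    (fun τ hτ => h2 τ hτ) ht).symm

lemma continuous_symbolA {σ : ℝ} (hσ : 0 ≤ σ) :
    Continuous fun ξ : Space n => Matrix.toEuclideanCLM (n := Fin 3) (𝕜 := ℂ) (symbolA σ ξ) := by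
  have h := continuous_absD (n := n)
  have h2 : Continuous fun ξ : Space n => absD ξ ^ (2 * σ) :=
    h.rpow_const fun _ => Or.inr (by positivity)
  simp only [symbolA, map_add, map_smul]
  fun_prop

lemma continuous_symbolRef :
    Continuous fun ξ : Space n => Matrix.toEuclideanCLM (n := Fin 3) (𝕜 := ℂ) (symbolRef ξ) := by
  have h := continuous_absD (n := n)
  simp only [symbolRef, map_smul]
  fun_prop

/-! ### Low frequency estimate and bounds on the data -/

lemma Diagonalizes.mul_diagonal {T : Matrix (Fin 3) (Fin 3) ℂ} (h : Diagonalizes T) :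
    T * Matrix.diagonal yRoot = A₀ * T := by
  rw [← h.2, ← mul_assoc, ← mul_assoc, Matrix.mul_nonsing_inv _ h.1, one_mul]

/-- The low frequency estimate of the difference to the reference solution. -/
lemma ae_norm_smul_sub_le {σ : ℝ} (hσ : 1 < σ) {χ : Space n → ℝ} {B : ℝ} (hB : ∀ ξ, |χ ξ| ≤ B)
    (hχ : Function.support χ ⊆ {ξ : Space n | absD ξ ≤ 1}) {T : Matrix (Fin 3) (Fin 3) ℂ}
    (hT : Diagonalizes T) {w₀ : Space n → C3} {w w' : ℝ → Space n → C3}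
    (hw : IsFourierSolution (symbolA σ) w₀ w)
    (hw' : IsFourierSolution symbolRef (fun ξ => Matrix.toEuclideanLin T⁻¹ (w₀ ξ)) w')
    {t : ℝ} (ht : 0 ≤ t) :
    ∀ᵐ ξ : Space n, ‖χ ξ • (w t ξ - Matrix.toEuclideanLin T (w' t ξ))‖ ≤
      B * 127 * Real.exp 1 * (heatMultiplier (2 * (σ - 1)) (1 + t) ξ * ‖w₀ ξ‖) := by
  have hB0 : 0 ≤ B := (abs_nonneg _).trans (hB 0)
  filter_upwards [hw, hw'] with ξ ⟨c1, d1, i1⟩ ⟨c2, d2, i2⟩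
  by_cases hξ : χ ξ = 0
  · rw [hξ, zero_smul, norm_zero]
    have := heatMultiplier_nonneg (2 * (σ - 1)) (1 + t) ξ
    positivity
  have hr1 : absD ξ ≤ 1 := hχ hξ
  have hr0 := absD_nonneg ξ
  set r := absD ξ with hr
  set ρ := r ^ (2 * (σ - 1)) with hρ
  have hρ0 : 0 ≤ ρ := Real.rpow_nonneg hr0 _
  have hρ1 : ρ ≤ 1 := Real.rpow_le_one hr0 hr1 (by linarith)
  have hqρ : r ^ (2 * σ) = r ^ 2 * ρ := by
    rw [hρ, ← Real.rpow_two, ← Real.rpow_add_of_nonneg hr0 (by norm_num) (by linarith)]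
    congr 1; ring
  have hTc : Continuous (Matrix.toEuclideanLin T : C3 → C3) :=
    (Matrix.toEuclideanCLM (n := Fin 3) (𝕜 := ℂ) T).continuous
  have dz : ∀ τ > 0, HasDerivAt (fun τ => Matrix.toEuclideanLin T (w' τ ξ))
      (-Matrix.toEuclideanLin (((r ^ 2 : ℝ) : ℂ) • A₀) (Matrix.toEuclideanLin T (w' τ ξ))) τ := by
    intro τ hτ
    refine ((((Matrix.toEuclideanCLM (n := Fin 3) (𝕜 := ℂ) T).restrictScalars ℝ).hasFDerivAt
      ).comp_hasDerivAt τ (d2 τ hτ)).congr_deriv ?_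
    change Matrix.toEuclideanLin T (-Matrix.toEuclideanLin (symbolRef ξ) (w' τ ξ)) = _
    have key : T * symbolRef ξ = ((r ^ 2 : ℝ) : ℂ) • A₀ * T := by
      rw [symbolRef, Matrix.mul_smul, hT.mul_diagonal, Matrix.smul_mul]
    have mul : ∀ (P Q : Matrix (Fin 3) (Fin 3) ℂ) (v : C3), Matrix.toEuclideanLin P
        (Matrix.toEuclideanLin Q v) = Matrix.toEuclideanLin (P * Q) v := fun P Q v => by
      simp [Matrix.toLpLin_apply, Matrix.mulVec_mulVec]
    rw [map_neg, mul, mul, key]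
  have hi : Matrix.toEuclideanLin T (w' 0 ξ) = w₀ ξ := by
    rw [i2]
    simp [Matrix.toLpLin_apply, Matrix.mulVec_mulVec, Matrix.mul_nonsing_inv _ hT.1]
  have main := norm_sub_sq_le (q := r ^ 2) (ρ := ρ) (by positivity) hρ0 hρ1 c1
    (hTc.comp_continuousOn c2) (fun τ hτ => by
      have := d1 τ hτ
      rwa [symbolA, ← hr, hqρ] at this) dz (by rw [i1]; exact hi.symm) ht
  rw [Function.comp_apply, Function.comp_apply, hi] at main
  have e : Real.exp (-(r ^ 2 / 20) * t) = Real.exp (-(r ^ 2 * t / 40)) ^ 2 := by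
    rw [← Real.exp_nat_mul]; congr 1; push_cast; ring
  -- The constant comes from `127² = 16129 ≥ 16000`.
  have h1 : ‖w t ξ - Matrix.toEuclideanLin T (w' t ξ)‖ ≤
      127 * ρ * Real.exp (-(r ^ 2 * t / 40)) * ‖w₀ ξ‖ := by
    refine abs_le_of_sq_le_sq' (main.trans ?_) (by positivity) |>.2
    rw [e]
    have : 0 ≤ (ρ * Real.exp (-(r ^ 2 * t / 40)) * ‖w₀ ξ‖) ^ 2 := sq_nonneg _
    nlinarith
  -- Since `r ≤ 1`, replacing `t` by `1 + t` costs a bounded factor and removes the singularity of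
  -- the decay rate at `t = 0`.
  have h2 : Real.exp (-(r ^ 2 * t / 40)) ≤
      Real.exp 1 * Real.exp (-(r ^ 2 * (1 + t) / 40)) := by
    rw [← Real.exp_add]
    gcongr
    nlinarith
  rw [norm_smul, Real.norm_eq_abs]
  calc |χ ξ| * ‖w t ξ - Matrix.toEuclideanLin T (w' t ξ)‖
      ≤ B * (127 * ρ * (Real.exp 1 * Real.exp (-(r ^ 2 * (1 + t) / 40))) * ‖w₀ ξ‖) :=
        mul_le_mul (hB ξ) (h1.trans (by gcongr)) (norm_nonneg _) hB0
    _ = _ := by rw [heatMultiplier]; ring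

lemma norm_initialData_le (v₀ u₁ θ₀ : Space n → ℂ) (x : Space n) :
    ‖initialData v₀ u₁ θ₀ x‖ ≤ 2 * (‖v₀ x‖ + ‖u₁ x‖ + ‖θ₀ x‖) := by
  refine abs_le_of_sq_le_sq' ?_ (by positivity) |>.2
  rw [norm_sq_eq_re_im]
  have hs : ∀ z : ℂ, z.re ^ 2 + z.im ^ 2 = ‖z‖ ^ 2 := fun z => by
    rw [← Complex.normSq_eq_norm_sq, Complex.normSq_apply]; ring
  have h1 := hs (v₀ x)
  have h2 := hs (u₁ x)
  have h3 := hs (θ₀ x)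
  simp [initialData]
  nlinarith [norm_nonneg (v₀ x), norm_nonneg (u₁ x), norm_nonneg (θ₀ x),
    mul_nonneg (norm_nonneg (v₀ x)) (norm_nonneg (u₁ x)),
    mul_nonneg (norm_nonneg (v₀ x)) (norm_nonneg (θ₀ x)),
    mul_nonneg (norm_nonneg (u₁ x)) (norm_nonneg (θ₀ x))]

lemma aestronglyMeasurable_initialData {v₀ u₁ θ₀ : Space n → ℂ}
    (hv : AEStronglyMeasurable v₀ volume) (hu : AEStronglyMeasurable u₁ volume)
    (hθ : AEStronglyMeasurable θ₀ volume) :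
    AEStronglyMeasurable (initialData v₀ u₁ θ₀) volume := by
  have hc : Continuous fun p : ℂ × ℂ × ℂ => (!₂[p.2.1 + p.1, p.2.1 - p.1, p.2.2] : C3) := by
    refine (PiLp.continuous_toLp 2 _).comp (continuous_pi fun i => ?_)
    fin_cases i <;> simp <;> fun_prop
  exact hc.comp_aestronglyMeasurable (hv.prodMk (hu.prodMk hθ))

lemma eLpNorm_initialData_le {p : ℝ≥0∞} (hp : 1 ≤ p) {v₀ u₁ θ₀ : Space n → ℂ}
    (hv : AEStronglyMeasurable v₀ volume) (hu : AEStronglyMeasurable u₁ volume)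
    (hθ : AEStronglyMeasurable θ₀ volume) :
    eLpNorm (initialData v₀ u₁ θ₀) p volume ≤
      ENNReal.ofReal 2 * (eLpNorm v₀ p volume + eLpNorm u₁ p volume + eLpNorm θ₀ p volume) := by
  calc eLpNorm (initialData v₀ u₁ θ₀) p volume
      ≤ eLpNorm ((2 : ℝ) • ((fun x => ‖v₀ x‖) + (fun x => ‖u₁ x‖) + fun x => ‖θ₀ x‖)) p volume :=
        eLpNorm_mono_real (norm_initialData_le v₀ u₁ θ₀)
    _ = ENNReal.ofReal 2 *
        eLpNorm ((fun x => ‖v₀ x‖) + (fun x => ‖u₁ x‖) + fun x => ‖θ₀ x‖) p volume := by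
        rw [eLpNorm_const_smul, Real.enorm_eq_ofReal (by norm_num)]
    _ ≤ _ := by
        gcongr
        refine (eLpNorm_add_le (hv.norm.add hu.norm) hθ.norm hp).trans ?_
        rw [eLpNorm_norm]
        gcongr
        refine (eLpNorm_add_le hv.norm hu.norm hp).trans ?_
        rw [eLpNorm_norm, eLpNorm_norm]

lemma exists_abs_le_of_support_subset {χ : Space n → ℝ} (hχ : Continuous χ)
    (hs : Function.support χ ⊆ {ξ : Space n | absD ξ ≤ 1}) : ∃ B > 0, ∀ ξ, |χ ξ| ≤ B := by
  have hc : HasCompactSupport χ := by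
    refine HasCompactSupport.intro (isCompact_closedBall (0 : Space n) 1) fun ξ hξ => ?_
    by_contra h
    have h1 : 2 * Real.pi * ‖ξ‖ ≤ 1 := hs h
    rw [mem_closedBall_zero_iff, not_le] at hξ
    nlinarith [Real.pi_gt_three]
  obtain ⟨B, hB⟩ := hχ.bounded_above_of_compact_support hc
  exact ⟨max B 1, by positivity, fun ξ => (hB ξ).trans (le_max_left _ _)⟩

end ThermoPlate

open ThermoPlate
theorem mainTheorem11 (σ : ℝ) (hσ : σ ∈ Ioc (1 : ℝ) 2) :
    ∃ ε : ℝ, 0 < ε ∧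
      ∀ (n : ℕ) (_ : 1 ≤ n) (m : ℝ) (_ : m ∈ Icc (1 : ℝ) 2) (s : ℝ) (_ : 0 ≤ s)
        (χ : Space n → ℝ) (_ : ContDiff ℝ ∞ χ)
        (_ : Function.support χ ⊆ {ξ : Space n | absD ξ ≤ ε})
        (T₀ : Matrix (Fin 3) (Fin 3) ℂ) (_ : Diagonalizes T₀),
      ∃ C : ℝ, 0 < C ∧
        ∀ (u₀ : 𝓢'(Space n, ℂ)) (v₀ u₁ θ₀ : Space n → ℂ)
          (_ : Represents v₀ (-(Δ u₀)))
          (_ : MemLp v₀ (ENNReal.ofReal m) volume)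
          (_ : MemLp u₁ (ENNReal.ofReal m) volume)
          (_ : MemLp θ₀ (ENNReal.ofReal m) volume)
          (w w' : ℝ → Space n → C3)
          (_ : IsFourierSolution (symbolA σ) (fourierHat (initialData v₀ u₁ θ₀)) w)
          (_ : IsFourierSolution symbolRef
            (fun ξ => Matrix.toEuclideanLin T₀⁻¹ (fourierHat (initialData v₀ u₁ θ₀) ξ)) w')
          (t : ℝ) (_ : 0 ≤ t),
        ∃ h : MemLp (fun ξ => χ ξ • (w t ξ - Matrix.toEuclideanLin T₀ (w' t ξ))) 2 volume,
          homSobolevNorm s (𝓕⁻ (h.toLp _)) ≤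
            ENNReal.ofReal
              (C * (1 + t) ^ (-(((2 - m) * n + 2 * m * s) / (4 * m)) - (σ - 1))) *
            (eLpNorm v₀ (ENNReal.ofReal m) volume + eLpNorm u₁ (ENNReal.ofReal m) volume
              + eLpNorm θ₀ (ENNReal.ofReal m) volume) := by
  obtain ⟨hσ1, hσ2⟩ := hσ
  -- The radius `1` is enough: all the energy estimate needs is `ρ = |ξ|^(2(σ-1)) ≤ 1`.
  refine ⟨1, one_pos, fun n _ m ⟨hm, hm2⟩ s hs χ hχ hsupp T₀ hT => ?_⟩
  obtain ⟨B, hB0, hB⟩ := exists_abs_le_of_support_subset hχ.continuous hsupp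
  set a := 2 * (σ - 1) with ha
  have ha0 : 0 ≤ a := by linarith
  have hm0 : 0 < m := by linarith
  -- The exponent `a` serves for membership in `L²`, and `s + a` below for the `Ḣ^s` bound.
  obtain ⟨K₀, hK₀, hK₀'⟩ := exists_eLpNorm_heatMultiplier_le n hm hm2 ha0
  obtain ⟨K, hK, hK'⟩ := exists_eLpNorm_heatMultiplier_le n hm hm2 (add_nonneg hs ha0)
  set B' := B * 127 * Real.exp 1 with hB'
  have hB'0 : 0 < B' := by positivity
  refine ⟨B' * K * 2, by positivity, fun u₀ v₀ u₁ θ₀ _ hv hu hθ w w' hw hw' t ht => ?_⟩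
  have hp : 1 ≤ ENNReal.ofReal m := by simpa using hm
  have hτ : 0 < 1 + t := by linarith
  set f := initialData v₀ u₁ θ₀ with hf
  have hfn := eLpNorm_initialData_le hp hv.1 hu.1 hθ.1
  rw [← hf] at hfn
  have hfm : MemLp f (ENNReal.ofReal m) volume :=
    ⟨aestronglyMeasurable_initialData hv.1 hu.1 hθ.1, hfn.trans_lt
      (ENNReal.mul_lt_top ENNReal.ofReal_lt_top
        (ENNReal.add_lt_top.2 ⟨ENNReal.add_lt_top.2 ⟨hv.2, hu.2⟩, hθ.2⟩))⟩
  have hfh := aestronglyMeasurable_fourierHat hm hfm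
  have bound := ae_norm_smul_sub_le hσ1 hB hsupp hT hw hw' ht
  rw [← hB', ← ha] at bound
  have hLin : ∀ T : Matrix (Fin 3) (Fin 3) ℂ, Continuous (Matrix.toEuclideanLin T : C3 → C3) :=
    fun T => (Matrix.toEuclideanCLM (n := Fin 3) (𝕜 := ℂ) T).continuous
  have hmeas : AEStronglyMeasurable
      (fun ξ => χ ξ • (w t ξ - Matrix.toEuclideanLin T₀ (w' t ξ))) volume :=
    hχ.continuous.aestronglyMeasurable.smul
      ((hw.aestronglyMeasurable (continuous_symbolA (by linarith)) hfh ht).sub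
        ((hLin T₀).comp_aestronglyMeasurable (hw'.aestronglyMeasurable continuous_symbolRef
          ((hLin T₀⁻¹).comp_aestronglyMeasurable hfh) ht)))
  have scale : ∀ b : ℝ, eLpNorm (fun ξ => B' * (heatMultiplier b (1 + t) ξ * ‖fourierHat f ξ‖)) 2
      volume = ENNReal.ofReal B' *
        eLpNorm (fun ξ => heatMultiplier b (1 + t) ξ * ‖fourierHat f ξ‖) 2 volume := fun b => by
    have := eLpNorm_const_smul B' (fun ξ => heatMultiplier b (1 + t) ξ * ‖fourierHat f ξ‖) 2
      (volume : Measure (Space n))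
    rwa [Real.enorm_eq_ofReal hB'0.le] at this
  have hmem : MemLp (fun ξ => χ ξ • (w t ξ - Matrix.toEuclideanLin T₀ (w' t ξ))) 2 volume := by
    refine ⟨hmeas, (eLpNorm_mono_ae_real bound).trans_lt ?_⟩
    rw [scale]
    exact ENNReal.mul_lt_top ENNReal.ofReal_lt_top ((hK₀' _ hτ f hfm).trans_lt
      (ENNReal.mul_lt_top ENNReal.ofReal_lt_top hfm.2))
  refine ⟨hmem, ?_⟩
  have bound_s : ∀ᵐ ξ : Space n, ‖absD ξ ^ s • (hmem.toLp _) ξ‖ ≤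
      B' * (heatMultiplier (s + a) (1 + t) ξ * ‖fourierHat f ξ‖) := by
    filter_upwards [bound, hmem.coeFn_toLp] with ξ h1 h2
    have hr := absD_nonneg ξ
    rw [h2, norm_smul, Real.norm_of_nonneg (Real.rpow_nonneg hr _)]
    refine (mul_le_mul_of_nonneg_left h1 (Real.rpow_nonneg hr _)).trans (le_of_eq ?_)
    rw [heatMultiplier, heatMultiplier, Real.rpow_add_of_nonneg hr hs ha0]
    ring
  rw [homSobolevNorm, FourierTransform.fourier_fourierInv_eq]
  calc _ ≤ eLpNorm (fun ξ => B' * (heatMultiplier (s + a) (1 + t) ξ * ‖fourierHat f ξ‖)) 2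
        volume := eLpNorm_mono_ae_real bound_s
    _ ≤ ENNReal.ofReal B' *
        (ENNReal.ofReal (K * (1 + t) ^ (-((2 - m) * n / (4 * m)) - (s + a) / 2)) *
        (ENNReal.ofReal 2 * (eLpNorm v₀ (ENNReal.ofReal m) volume +
          eLpNorm u₁ (ENNReal.ofReal m) volume + eLpNorm θ₀ (ENNReal.ofReal m) volume))) := by
        rw [scale]
        gcongr
        exact (hK' _ hτ f hfm).trans (by gcongr)
    _ = _ := by
        rw [← mul_assoc, ← mul_assoc, ← ENNReal.ofReal_mul hB'0.le,
          ← ENNReal.ofReal_mul (by positivity)]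
        congr 2
        -- With `a = 2 (σ - 1)`, the half `a / 2` of the frequency gain is exactly the additional
        -- decay `σ - 1`.
        rw [show -((2 - m) * n / (4 * m)) - (s + a) / 2 =
          -(((2 - m) * n + 2 * m * s) / (4 * m)) - (σ - 1) by rw [ha]; field_simp; ring]
        ring
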